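/- Let $\mathbb T^d=\mathbb R^d/\mathbb Z^d$ with normalised Lebesgue measure $dx$. A function $f:\mathbb T^d\to\mathbb R$ has mean zero if $\int_{\mathbb T^d} f\,dx=0$, and $\|f\|_q^q=\int_{\mathbb T^d}|f|^q\,dx$. Let $\hat f(n)=\int_{\mathbb T^d} f(x)e^{-2\pi i n\cdot x}\,dx$ for $n\in\mathbb Z^d$. For $0<\alpha<2$ and $f\in C^2(\mathbb T^d)$, $|\nabla|^\alpha f$ denotes the (a.e. unique) real-valued integrable function on $\mathbb T^d$ with Fourier coefficients $\widehat{|\nabla|^\alpha f}(n)=(2\pi|n|)^\alpha\hat f(n)$, $n\in\mathbb Z^d$, where $|n|$ is the Euclidean length; such a function exists (this is part of the claim). The expression $|f|^{q-2}f$ is read as $0$ where $f=0$. (i) For every integer $d\ge 1$ and every $0<\alpha<2$ there is a constant $c_1>0$, depending only on $\alpha$ and $d$, such that for every real-valued $f\in C^2(\mathbb T^d)$ with mean zero and every $1<q<\infty$, $$\int_{\mathbb T^d}(|\nabla|^\alpha f)\,|f|^{q-2}f\,dx\ \ge\ c_1\,\|f\|_q^q .$$ (ii) There is an absolute constant $c_2>0$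 (in particular independent of $d$, $q$ and $f$) such that for every integer $d\ge1$, every real-valued $f\in C^2(\mathbb T^d)$ with mean zero and every $1<q<\infty$, $$-\int_{\mathbb T^d}(\Delta f)\,|f|^{q-2}f\,dx\ \ge\ c_2\,\frac{q-1}{q^2}\,\|f\|_q^q ,$$ where $\Delta f=\sum_{j=1}^d\partial_j^2 f$ is the classical Laplacian. -/

import Mathlib

open MeasureTheory Real

noncomputable section

/-- The normalised Haar (Lebesgue) measure `dx` on the torus `𝕋^d = ℝ^d / ℤ^d`. It is the measure
used by `UnitAddTorus.mFourierCoeff`. -/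
abbrev torusMeasure (d : ℕ) : Measure (UnitAddTorus (Fin d)) :=
  Measure.pi fun _ => AddCircle.haarAddCircle

/-- It is also the default volume, i.e. the product of the quotient Lebesgue measures. -/
theorem torusMeasure_eq_volume (d : ℕ) :
    torusMeasure d = (volume : Measure (UnitAddTorus (Fin d))) := by
  have h : (AddCircle.haarAddCircle : Measure UnitAddCircle) = volume := by
    rw [AddCircle.volume_eq_smul_haarAddCircle]
    simp
  rw [torusMeasure, h]
  rfl

/-- The quotient map `ℝ^d → 𝕋^d = ℝ^d / ℤ^d`. -/
def toTorus {d : ℕ} (x : EuclideanSpace ℝ (Fin d)) : UnitAddTorus (Fin d) :=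
  fun i => (x i : UnitAddCircle)

/-- `f ∈ C²(𝕋^d)`: the `ℤ^d`-periodic function on `ℝ^d` given by `f` is `C²`. -/
def IsC2Torus {d : ℕ} (f : UnitAddTorus (Fin d) → ℝ) : Prop :=
  ContDiff ℝ 2 fun x : EuclideanSpace ℝ (Fin d) => f (toTorus x)

/-- `f` has mean zero: `∫_{𝕋^d} f(x) dx = 0`. -/
def HasMeanZero {d : ℕ} (f : UnitAddTorus (Fin d) → ℝ) : Prop :=
  ∫ x, f x ∂(torusMeasure d) = 0

/-- The classical Laplacian of `f : 𝕋^d → ℝ` at `x`: the Laplacian of `y ↦ f (x + y)`, as a function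
of `y ∈ ℝ^d`, at `y = 0`. -/
def torusLaplacian {d : ℕ} (f : UnitAddTorus (Fin d) → ℝ) (x : UnitAddTorus (Fin d)) : ℝ :=
  Laplacian.laplacian (fun y : EuclideanSpace ℝ (Fin d) => f (x + toTorus y)) 0

/-- `g = |∇|^α f` on `𝕋^d`: `g` is the (a.e. unique) integrable function with Fourier coefficients
`ĝ(n) = (2π|n|)^α f̂(n)`, `n ∈ ℤ^d`, where `|n|` is the Euclidean length of `n`. -/
def IsFracLaplacian {d : ℕ} (α : ℝ) (f g : UnitAddTorus (Fin d) → ℝ) : Prop :=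
  Integrable g (torusMeasure d) ∧
    ∀ n : Fin d → ℤ,
      UnitAddTorus.mFourierCoeff (fun x => (g x : ℂ)) n =
        (((2 * π * √(∑ i, (n i : ℝ) ^ 2)) ^ α : ℝ) : ℂ) *
          UnitAddTorus.mFourierCoeff (fun x => (f x : ℂ)) n

end

/- Put `φ t = |t|^{q-2} t` and `u = |f|^{q/2} sgn f`. For the Laplacian, the Stroock–Varopoulos
inequality `(a - b) (φ a - φ b) ≥ 4 (q - 1) / q² (u a - u b)²`, applied to values of `f` at
points differing by a coordinate step `h` and divided by `h²`, becomes together with Parseval's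
identity the Poincaré inequality `-∫ Δf φ(f) ≥ 4 (q - 1) / q² · 4π² Var u` as `h → 0`, while
`∫ f = 0` forces `∫ |f|^q ≤ 2 Var u`. For `|∇|^α`, write the operator as an integral of second
differences against the kernel `|y|^{-(d+α)}`. Tested against `φ(f)` every second difference is
nonnegative, the kernel is at least `d^{-(d+α)/2}` on the unit cube, and the integral of the
second differences over the cube is exactly `2 ∫ |f|^q` because `f` has mean zero. -/

open Filter Topology

section SignedPow

/-- The odd extension of `t ↦ t ^ r` from `[0, ∞)` to the real line. The paper's `|f|^{q-2} f` is
`signedPow (q - 1) f`; at `t = 0` the last factor makes the value `0` for every `r`. -/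
noncomputable def signedPow (r t : ℝ) : ℝ := |t| ^ (r - 1) * t

theorem signedPow_of_nonneg {r t : ℝ} (hr : r ≠ 0) (ht : 0 ≤ t) : signedPow r t = t ^ r := by
  rcases ht.eq_or_lt with rfl | h
  · simp [signedPow, Real.zero_rpow hr]
  · rw [signedPow, abs_of_pos h, Real.rpow_sub_one h.ne', div_mul_cancel₀ _ h.ne']

theorem signedPow_neg (r t : ℝ) : signedPow r (-t) = -signedPow r t := by
  simp [signedPow]

theorem abs_signedPow {r : ℝ} (hr : r ≠ 0) (t : ℝ) : |signedPow r t| = |t| ^ r := by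
  rw [← signedPow_of_nonneg hr (abs_nonneg t), signedPow, signedPow, abs_mul, abs_abs,
    abs_of_nonneg (Real.rpow_nonneg (abs_nonneg t) _)]

theorem continuous_signedPow {r : ℝ} (hr : 0 < r) : Continuous (signedPow r) := by
  refine continuous_iff_continuousAt.2 fun t => ?_
  rcases eq_or_ne t 0 with rfl | ht
  · have h0 : signedPow r 0 = 0 := by simp [signedPow]
    rw [ContinuousAt, h0, tendsto_zero_iff_abs_tendsto_zero]
    simpa only [Function.comp_def, abs_signedPow hr.ne', abs_zero, Real.zero_rpow hr.ne']
      using (continuous_abs.rpow_const fun _ => Or.inr hr.le).tendsto (0 : ℝ)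
  · exact (continuousAt_id.abs.rpow_const (Or.inl (abs_ne_zero.2 ht))).mul continuousAt_id

theorem signedPow_half_sq {q : ℝ} (hq : q ≠ 0) (t : ℝ) : signedPow (q / 2) t ^ 2 = |t| ^ q := by
  rw [← sq_abs, abs_signedPow (by simpa using hq), ← Real.rpow_mul_natCast (abs_nonneg t)]
  norm_num

theorem signedPow_sub_one_eq (q t : ℝ) :
    signedPow (q - 1) t = (|t| ^ (q / 2 - 1)) ^ 2 * t := by
  rw [signedPow, ← Real.rpow_mul_natCast (abs_nonneg t)]
  ring_nf

theorem abs_rpow_sub_two_mul (q t : ℝ) : |t| ^ (q - 2) * t = signedPow (q - 1) t := by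
  rw [signedPow, sub_sub, one_add_one_eq_two]

theorem mul_signedPow_sub_one {q : ℝ} (hq : q ≠ 0) (t : ℝ) :
    t * signedPow (q - 1) t = |t| ^ q := by
  rw [← signedPow_half_sq hq, signedPow_sub_one_eq, signedPow]
  ring

theorem hasDerivAt_signedPow_of_pos {r t : ℝ} (hr : r ≠ 0) (ht : 0 < t) :
    HasDerivAt (signedPow r) (r * t ^ (r - 1)) t :=
  (Real.hasDerivAt_rpow_const (Or.inl ht.ne')).congr_of_eventuallyEq <| by
    filter_upwards [lt_mem_nhds ht] with s hs using signedPow_of_nonneg hr hs.le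

/-- On `(0, ∞)` the derivative is the square `(t ^ (q / 2 - 1) - l) ^ 2`. -/
theorem monotone_signedPow_quadratic {q : ℝ} (hq : 1 < q) (l : ℝ) :
    Monotone fun t : ℝ =>
      t * (l * l) - 4 / q * signedPow (q / 2) t * l + signedPow (q - 1) t / (q - 1) := by
  have hq1 : q - 1 ≠ 0 := by linarith
  have hcont : Continuous fun t : ℝ =>
      t * (l * l) - 4 / q * signedPow (q / 2) t * l + signedPow (q - 1) t / (q - 1) := by
    have h1 := continuous_signedPow (show 0 < q / 2 by linarith)
    have h2 := continuous_signedPow (show 0 < q - 1 by linarith)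
    fun_prop
  refine monotone_of_odd_of_monotoneOn_nonneg (fun t => by simp only [signedPow_neg]; ring) ?_
  refine monotoneOn_of_hasDerivWithinAt_nonneg (convex_Ici 0) hcont.continuousOn
    (f' := fun t => (t ^ (q / 2 - 1) - l) ^ 2) (fun t ht => ?_) fun t _ => sq_nonneg _
  have ht0 : 0 < t := by simpa using ht
  have hsq : t ^ (q - 1 - 1) = (t ^ (q / 2 - 1)) ^ 2 := by
    rw [← Real.rpow_mul_natCast ht0.le]
    ring_nf
  refine (((((hasDerivAt_id t).mul_const (l * l)).sub (((hasDerivAt_signedPow_of_pos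
    (by linarith) ht0).const_mul (4 / q)).mul_const l)).add ((hasDerivAt_signedPow_of_pos hq1
    ht0).div_const (q - 1))).congr_deriv ?_).hasDerivWithinAt
  rw [hsq]
  field_simp
  ring

/-- The Stroock–Varopoulos inequality. With `u = signedPow (q / 2)` and `φ = signedPow (q - 1)`, it
is the Cauchy–Schwarz inequality for `u' = (q / 2) t ^ (q / 2 - 1)` on `[b, a]`, here in the form
of a nonpositive discriminant. -/
theorem stroock_varopoulos {q : ℝ} (hq : 1 < q) (a b : ℝ) :
    4 * (q - 1) / q ^ 2 * (signedPow (q / 2) a - signedPow (q / 2) b) ^ 2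
      ≤ (a - b) * (signedPow (q - 1) a - signedPow (q - 1) b) := by
  wlog hab : b ≤ a generalizing a b
  · linarith [this b a (le_of_not_ge hab)]
  have hq1 : 0 < q - 1 := by linarith
  have hdisc : discrim (a - b) (-(4 / q * (signedPow (q / 2) a - signedPow (q / 2) b)))
      ((signedPow (q - 1) a - signedPow (q - 1) b) / (q - 1)) ≤ 0 := by
    refine discrim_le_zero fun l => ?_
    have := monotone_signedPow_quadratic hq l hab
    simp only [sub_div] at this ⊢
    linarith
  rw [discrim] at hdisc
  calc 4 * (q - 1) / q ^ 2 * (signedPow (q / 2) a - signedPow (q / 2) b) ^ 2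
      = (q - 1) / 4 * (-(4 / q * (signedPow (q / 2) a - signedPow (q / 2) b))) ^ 2 := by ring
    _ ≤ (q - 1) / 4 * (4 * (a - b) * ((signedPow (q - 1) a - signedPow (q - 1) b) / (q - 1))) := by
        gcongr
        linarith
    _ = (a - b) * (signedPow (q - 1) a - signedPow (q - 1) b) := by field_simp

theorem sub_mul_signedPow_sub_nonneg {q : ℝ} (hq : 1 < q) (a b : ℝ) :
    0 ≤ (a - b) * (signedPow (q - 1) a - signedPow (q - 1) b) :=
  le_trans (mul_nonneg (div_nonneg (by linarith) (sq_nonneg q)) (sq_nonneg _))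
    (stroock_varopoulos hq a b)

theorem sub_mul_signedPow_sub_le {q : ℝ} (hq : 1 < q) (a b : ℝ) :
    (a - b) * (signedPow (q - 1) a - signedPow (q - 1) b)
      ≤ 2 * (signedPow (q / 2) a - signedPow (q / 2) b) ^ 2 := by
  have hneg := sub_mul_signedPow_sub_nonneg hq a (-b)
  rw [signedPow_neg] at hneg
  simp only [signedPow_sub_one_eq] at hneg ⊢
  rw [signedPow, signedPow]
  set c := |a| ^ (q / 2 - 1)
  set e := |b| ^ (q / 2 - 1)
  have hce : 0 ≤ c * e := by positivity
  -- The difference of the two sides is `(c a - e b)² + a b (c - e)²`, and also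
  -- `(a + b) (c² a + e² b) - 4 c e a b`.
  rcases le_total 0 (a * b) with hab | hab
  · nlinarith [mul_nonneg hab (sq_nonneg (c - e)), sq_nonneg (c * a - e * b)]
  · nlinarith [mul_nonneg hce (neg_nonneg.2 hab)]

end SignedPow

section Variance

variable {X : Type*} [MeasurableSpace X] {μ : Measure X}

theorem integrable_prod_sub_mul_sub [IsFiniteMeasure μ] {f g : X → ℝ} (hf : Integrable f μ)
    (hg : Integrable g μ) (hfg : Integrable (fun x => f x * g x) μ) :
    Integrable (fun z : X × X => (f z.1 - f z.2) * (g z.1 - g z.2)) (μ.prod μ) := by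
  refine (((hfg.comp_fst μ).sub (hf.mul_prod hg)).sub ((hg.mul_prod hf).sub
    (hfg.comp_snd μ))).congr (Eventually.of_forall fun z => ?_)
  simp only [Pi.sub_apply]
  ring

theorem integral_prod_sub_mul_sub [IsProbabilityMeasure μ] {f g : X → ℝ} (hf : Integrable f μ)
    (hg : Integrable g μ) (hfg : Integrable (fun x => f x * g x) μ) :
    ∫ z, (f z.1 - f z.2) * (g z.1 - g z.2) ∂μ.prod μ
      = 2 * (∫ x, f x * g x ∂μ - (∫ x, f x ∂μ) * ∫ x, g x ∂μ) := by
  have hexpand : ∀ z : X × X, (f z.1 - f z.2) * (g z.1 - g z.2)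
      = f z.1 * g z.1 - f z.1 * g z.2 - (g z.1 * f z.2 - f z.2 * g z.2) := fun z => by ring
  simp_rw [hexpand]
  have h1 : Integrable (fun z : X × X => f z.1 * g z.1 - f z.1 * g z.2) (μ.prod μ) :=
    (hfg.comp_fst μ).sub (hf.mul_prod hg)
  have h2 : Integrable (fun z : X × X => g z.1 * f z.2 - f z.2 * g z.2) (μ.prod μ) :=
    (hg.mul_prod hf).sub (hfg.comp_snd μ)
  rw [integral_sub h1 h2, integral_sub (hfg.comp_fst μ) (hf.mul_prod hg),
    integral_sub (hg.mul_prod hf) (hfg.comp_snd μ),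
    integral_fun_fst (fun x => f x * g x), integral_fun_snd (fun x => f x * g x),
    integral_prod_mul, integral_prod_mul, probReal_univ, one_smul]
  ring

theorem integrable_signedPow [IsFiniteMeasure μ] {f : X → ℝ} {q r : ℝ} (hr : 0 < r) (hrq : r ≤ q)
    (hf : MemLp f (ENNReal.ofReal q) μ) : Integrable (fun x => signedPow r (f x)) μ := by
  have hfr := (hf.mono_exponent (ENNReal.ofReal_le_ofReal hrq)).integrable_norm_rpow'
  rw [ENNReal.toReal_ofReal hr.le] at hfr
  refine hfr.mono' ((continuous_signedPow hr).comp_aestronglyMeasurable hf.1)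
    (Eventually.of_forall fun x => ?_)
  rw [Real.norm_eq_abs, Real.norm_eq_abs, abs_signedPow hr.ne']

theorem integral_abs_rpow_le_two_mul_variance_signedPow [IsProbabilityMeasure μ] {f : X → ℝ}
    {q : ℝ} (hq : 1 < q) (hf : MemLp f (ENNReal.ofReal q) μ) (h0 : ∫ x, f x ∂μ = 0) :
    ∫ x, |f x| ^ q ∂μ
      ≤ 2 * (∫ x, |f x| ^ q ∂μ - (∫ x, signedPow (q / 2) (f x) ∂μ) ^ 2) := by
  have hq0 : q ≠ 0 := by linarith
  have hfi : Integrable f μ := hf.integrable (by simpa using hq.le)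
  have hφ := integrable_signedPow (show 0 < q - 1 by linarith) (by linarith) hf
  have hu := integrable_signedPow (show 0 < q / 2 by linarith) (by linarith) hf
  have hfq : Integrable (fun x => |f x| ^ q) μ := by
    simpa [ENNReal.toReal_ofReal (show 0 ≤ q by linarith)] using hf.integrable_norm_rpow'
  have hfφ : Integrable (fun x => f x * signedPow (q - 1) (f x)) μ := by
    simpa only [mul_signedPow_sub_one hq0] using hfq
  have huu : Integrable (fun x => signedPow (q / 2) (f x) * signedPow (q / 2) (f x)) μ := by
    simpa only [← sq, signedPow_half_sq hq0] using hfq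
  have h := integral_mono (integrable_prod_sub_mul_sub hfi hφ hfφ)
    ((integrable_prod_sub_mul_sub hu hu huu).const_mul 2)
    fun z => (sub_mul_signedPow_sub_le hq (f z.1) (f z.2)).trans_eq (by rw [sq])
  rw [integral_const_mul, integral_prod_sub_mul_sub hfi hφ hfφ,
    integral_prod_sub_mul_sub hu hu huu, h0] at h
  simp only [mul_signedPow_sub_one hq0, ← sq, signedPow_half_sq hq0] at h
  linarith

end Variance

section SecondDifference

variable {E : Type*} [NormedAddCommGroup E] [NormedSpace ℝ E]

theorem tendsto_sub_div_sq_of_hasDerivAt {g g' : ℝ → ℝ} {c : ℝ} (hg : ∀ s, HasDerivAt g (g' s) s)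
    (h0 : g' 0 = 0) (hg' : HasDerivAt g' c 0) :
    Tendsto (fun s => (g s - g 0) / s ^ 2) (𝓝[≠] 0) (𝓝 (c / 2)) := by
  refine HasDerivAt.lhopital_zero_nhdsNE (f' := g') (g' := fun s => 2 * s)
    (.of_forall fun s => (hg s).sub_const _) (.of_forall fun s => by simpa using hasDerivAt_pow 2 s)
    ?_ ?_ ?_ ?_
  · filter_upwards [self_mem_nhdsWithin] with s hs using mul_ne_zero two_ne_zero hs
  · have hcont := ((hg 0).sub_const (g 0)).continuousAt.tendsto
    rw [sub_self] at hcont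
    exact hcont.mono_left nhdsWithin_le_nhds
  · have hcont := (continuous_pow 2 (M := ℝ)).tendsto 0
    rw [zero_pow two_ne_zero] at hcont
    exact hcont.mono_left nhdsWithin_le_nhds
  · refine ((hasDerivAt_iff_tendsto_slope_zero.1 hg').div_const 2).congr fun s => ?_
    rw [zero_add, h0, sub_zero, smul_eq_mul, div_eq_mul_inv, mul_comm 2 s, div_mul_eq_div_div]
    ring

theorem hasDerivAt_add_add_sub {F : E → ℝ} (hF : Differentiable ℝ F) (x e : E) (s : ℝ) :
    HasDerivAt (fun s : ℝ => F (x + s • e) + F (x - s • e))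
      (fderiv ℝ F (x + s • e) e - fderiv ℝ F (x - s • e) e) s := by
  have hl : HasDerivAt (fun s : ℝ => s • e) e s := by simpa using (hasDerivAt_id s).smul_const e
  have h1 := (hF (x + s • e)).hasFDerivAt.comp_hasDerivAt s (hl.const_add x)
  have h2 := (hF (x - s • e)).hasFDerivAt.comp_hasDerivAt s (hl.const_sub x)
  exact (h1.add h2).congr_deriv (by simp [sub_eq_add_neg])

theorem tendsto_second_difference_div_sq {F : E → ℝ} {x : E} (hF : Differentiable ℝ F)
    (hF' : DifferentiableAt ℝ (fderiv ℝ F) x) (e : E) :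
    Tendsto (fun h : ℝ => (F (x + h • e) + F (x - h • e) - 2 * F x) / h ^ 2) (𝓝[≠] 0)
      (𝓝 (fderiv ℝ (fderiv ℝ F) x e e)) := by
  have hderiv : HasDerivAt (fun s : ℝ => fderiv ℝ F (x + s • e) e - fderiv ℝ F (x - s • e) e)
      (2 * fderiv ℝ (fderiv ℝ F) x e e) 0 := by
    have hline : ∀ v : E, HasDerivAt (fun s : ℝ => fderiv ℝ F (x + s • v) e)
        (fderiv ℝ (fderiv ℝ F) x v e) 0 := fun v =>
      (hF'.hasFDerivAt.hasLineDerivAt v).clm_apply (hasDerivAt_const (0 : ℝ) e) |>.congr_deriv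
        (by simp)
    refine (((hline e).sub (hline (-e))).congr_deriv (by simp; ring)).congr_of_eventuallyEq ?_
    exact .of_forall fun s => by simp [sub_eq_add_neg]
  have := tendsto_sub_div_sq_of_hasDerivAt (hasDerivAt_add_add_sub hF x e) (by simp) hderiv
  simpa [two_mul] using this

theorem abs_second_difference_le {F : E → ℝ} {K : NNReal} (hF : Differentiable ℝ F)
    (hF' : LipschitzWith K (fderiv ℝ F)) (x y : E) :
    |F (x + y) + F (x - y) - 2 * F x| ≤ 2 * K * ‖y‖ ^ 2 := by
  have hderiv : ∀ s ∈ Set.Icc (0 : ℝ) 1,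
      ‖fderiv ℝ F (x + s • y) y - fderiv ℝ F (x - s • y) y‖ ≤ 2 * K * ‖y‖ ^ 2 := fun s hs => by
    calc ‖fderiv ℝ F (x + s • y) y - fderiv ℝ F (x - s • y) y‖
        ≤ ‖fderiv ℝ F (x + s • y) - fderiv ℝ F (x - s • y)‖ * ‖y‖ :=
          (fderiv ℝ F (x + s • y) - fderiv ℝ F (x - s • y)).le_opNorm y
      _ ≤ K * ‖(x + s • y) - (x - s • y)‖ * ‖y‖ := by
          gcongr
          exact hF'.norm_sub_le _ _
      _ = 2 * K * s * ‖y‖ ^ 2 := by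
          rw [show (x + s • y) - (x - s • y) = (2 * s) • y by module, norm_smul, Real.norm_eq_abs,
            abs_of_nonneg (by linarith [hs.1])]
          ring
      _ ≤ 2 * K * ‖y‖ ^ 2 := by
          have hK : 2 * (K : ℝ) * s ≤ 2 * K := mul_le_of_le_one_right (by positivity) hs.2
          exact mul_le_mul_of_nonneg_right hK (sq_nonneg _)
  have := (convex_Icc (0 : ℝ) 1).norm_image_sub_le_of_norm_hasDerivWithin_le
    (fun s _ => (hasDerivAt_add_add_sub hF x y s).hasDerivWithinAt) hderiv
    (Set.left_mem_Icc.2 zero_le_one) (Set.right_mem_Icc.2 zero_le_one)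
  simpa [two_mul] using this

end SecondDifference

section CompactGroup

theorem integrable_of_continuous {X F : Type*} [TopologicalSpace X]
    [CompactSpace X] [MeasurableSpace X] [OpensMeasurableSpace X] [NormedAddCommGroup F]
    {ν : Measure X} [IsFiniteMeasureOnCompacts ν] {g : X → F} (hg : Continuous g) :
    Integrable g ν :=
  hg.integrable_of_hasCompactSupport (HasCompactSupport.of_compactSpace g)

variable {G : Type*} [AddCommGroup G]

/-- The symmetric second difference of a function on an additive group, with the sign for which it
discretises the positive operator `-∂²`. -/
def secondDiff (f : G → ℝ) (x t : G) : ℝ :=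
  2 * f x - f (x + t) - f (x - t)

variable {f ψ : G → ℝ}

theorem abs_secondDiff_le_of_abs_le {M : ℝ} (hM : ∀ x, |f x| ≤ M) (x t : G) :
    |secondDiff f x t| ≤ 4 * M := by
  have h₀ := abs_le.1 (hM x)
  have h₁ := abs_le.1 (hM (x + t))
  have h₂ := abs_le.1 (hM (x - t))
  rw [secondDiff, abs_le]
  constructor <;> linarith

variable [TopologicalSpace G] [IsTopologicalAddGroup G]

theorem continuous_secondDiff (hf : Continuous f) :
    Continuous fun z : G × G => secondDiff f z.1 z.2 := by
  unfold secondDiff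
  fun_prop

variable [CompactSpace G] [MeasurableSpace G] [BorelSpace G] {μ : Measure G} [IsFiniteMeasure μ]

theorem integral_secondDiff_mul [μ.IsAddLeftInvariant] (hf : Continuous f) (hψ : Continuous ψ)
    (t : G) :
    ∫ x, secondDiff f x t * ψ x ∂μ = ∫ x, (f x - f (x + t)) * (ψ x - ψ (x + t)) ∂μ := by
  have h1 : Integrable (fun x => (f x - f (x + t)) * ψ x) μ :=
    integrable_of_continuous (by fun_prop)
  have h2 : Integrable (fun x => (f x - f (x - t)) * ψ x) μ :=
    integrable_of_continuous (by fun_prop)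
  have h3 : Integrable (fun x => (f (x + t) - f x) * ψ (x + t)) μ :=
    integrable_of_continuous (by fun_prop)
  calc ∫ x, secondDiff f x t * ψ x ∂μ
      = ∫ x, ((f x - f (x + t)) * ψ x + (f x - f (x - t)) * ψ x) ∂μ := by
        refine integral_congr_ae (.of_forall fun x => ?_)
        simp only [secondDiff]
        ring
    _ = ∫ x, (f x - f (x + t)) * ψ x ∂μ + ∫ x, (f (x + t) - f x) * ψ (x + t) ∂μ := by
        rw [integral_add h1 h2, ← integral_add_right_eq_self (fun x => (f x - f (x - t)) * ψ x) t]
        simp only [add_sub_cancel_right]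
    _ = ∫ x, (f x - f (x + t)) * (ψ x - ψ (x + t)) ∂μ := by
        rw [← integral_add h1 h3]
        ring_nf

theorem integral_integral_secondDiff_mul [SecondCountableTopology G] [μ.IsAddLeftInvariant]
    [IsProbabilityMeasure μ] (hf : Continuous f) (hψ : Continuous ψ) :
    ∫ t, ∫ x, secondDiff f x t * ψ x ∂μ ∂μ
      = 2 * (∫ x, f x * ψ x ∂μ - (∫ x, f x ∂μ) * ∫ x, ψ x ∂μ) := by
  have hcont : Continuous (Function.uncurry fun t x : G =>
      (f x - f (x + t)) * (ψ x - ψ (x + t))) := by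
    unfold Function.uncurry; fun_prop
  have hswap : Integrable (Function.uncurry fun x y : G => (f x - f y) * (ψ x - ψ y)) (μ.prod μ) :=
    integrable_of_continuous (by unfold Function.uncurry; fun_prop)
  calc ∫ t, ∫ x, secondDiff f x t * ψ x ∂μ ∂μ
      = ∫ x, ∫ t, (f x - f (x + t)) * (ψ x - ψ (x + t)) ∂μ ∂μ := by
        simp_rw [integral_secondDiff_mul hf hψ]
        exact integral_integral_swap (integrable_of_continuous hcont)
    _ = ∫ x, ∫ y, (f x - f y) * (ψ x - ψ y) ∂μ ∂μ := by
        congr with x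
        exact integral_add_left_eq_self (fun y => (f x - f y) * (ψ x - ψ y)) x
    _ = 2 * (∫ x, f x * ψ x ∂μ - (∫ x, f x ∂μ) * ∫ x, ψ x ∂μ) := by
        rw [integral_integral hswap]
        exact integral_prod_sub_mul_sub (integrable_of_continuous hf)
          (integrable_of_continuous hψ)
          (integrable_of_continuous (hf.mul hψ))

theorem integral_sq_signedPow_sub_le_integral_secondDiff_mul [μ.IsAddLeftInvariant]
    (hf : Continuous f) {q : ℝ} (hq : 1 < q) (t : G) :
    4 * (q - 1) / q ^ 2 * ∫ x, (signedPow (q / 2) (f x) - signedPow (q / 2) (f (x + t))) ^ 2 ∂μ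
      ≤ ∫ x, secondDiff f x t * signedPow (q - 1) (f x) ∂μ := by
  have hu : Continuous (signedPow (q / 2)) := continuous_signedPow (by linarith)
  have hφ : Continuous (signedPow (q - 1)) := continuous_signedPow (by linarith)
  rw [integral_secondDiff_mul (ψ := fun x => signedPow (q - 1) (f x)) hf (hφ.comp hf),
    ← integral_const_mul]
  exact integral_mono (integrable_of_continuous (by fun_prop))
    (integrable_of_continuous (by fun_prop)) fun x => stroock_varopoulos hq _ _

theorem integral_secondDiff_mul_signedPow_nonneg [μ.IsAddLeftInvariant]
    (hf : Continuous f) {q : ℝ} (hq : 1 < q) (t : G) :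
    0 ≤ ∫ x, secondDiff f x t * signedPow (q - 1) (f x) ∂μ := by
  rw [integral_secondDiff_mul (ψ := fun x => signedPow (q - 1) (f x)) hf
    ((continuous_signedPow (by linarith)).comp hf)]
  exact integral_nonneg fun x => sub_mul_signedPow_sub_nonneg hq _ _

theorem integrable_integral_secondDiff_mul [SecondCountableTopology G] (hf : Continuous f)
    (hψ : Continuous ψ) : Integrable (fun t => ∫ x, secondDiff f x t * ψ x ∂μ) μ :=
  (integrable_of_continuous (ν := μ.prod μ)
    ((continuous_secondDiff hf).mul (hψ.comp continuous_fst))).integral_prod_right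

end CompactGroup

section Torus

variable {d : ℕ}

theorem toTorus_add (x y : EuclideanSpace ℝ (Fin d)) :
    toTorus (x + y) = toTorus x + toTorus y := by
  ext i; simp [toTorus]

theorem toTorus_neg (x : EuclideanSpace ℝ (Fin d)) : toTorus (-x) = -toTorus x := by
  ext i; simp [toTorus]

theorem toTorus_sub (x y : EuclideanSpace ℝ (Fin d)) :
    toTorus (x - y) = toTorus x - toTorus y := by
  ext i; simp [toTorus]

theorem toTorus_zero : toTorus (0 : EuclideanSpace ℝ (Fin d)) = 0 := by
  ext; simp [toTorus]

theorem isQuotientMap_toTorus : IsQuotientMap (toTorus (d := d)) := by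
  have h : IsOpenQuotientMap (Pi.map fun (_ : Fin d) (t : ℝ) => (t : UnitAddCircle)) :=
    IsOpenQuotientMap.piMap fun _ => QuotientAddGroup.isOpenQuotientMap_mk
  exact h.isQuotientMap.comp (PiLp.homeomorph 2 (fun _ : Fin d => ℝ)).isQuotientMap

/-- The cube `(0, 1]^d`, a fundamental domain of `toTorus`. -/
def unitCube (d : ℕ) : Set (EuclideanSpace ℝ (Fin d)) := {x | ∀ i, x i ∈ Set.Ioc (0 : ℝ) 1}

theorem unitCube_eq_preimage :
    unitCube d = WithLp.ofLp ⁻¹' Set.univ.pi fun _ => Set.Ioc (0 : ℝ) (0 + 1) := by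
  ext x
  simp [unitCube]

theorem measurableSet_unitCube : MeasurableSet (unitCube d) := by
  rw [unitCube_eq_preimage]
  exact (WithLp.measurable_ofLp 2 _) (MeasurableSet.univ_pi fun _ => measurableSet_Ioc)

theorem norm_le_sqrt_of_mem_unitCube {x : EuclideanSpace ℝ (Fin d)} (hx : x ∈ unitCube d) :
    ‖x‖ ≤ √d := by
  rw [EuclideanSpace.norm_eq]
  refine Real.sqrt_le_sqrt ?_
  calc ∑ i, ‖x i‖ ^ 2 ≤ ∑ _i : Fin d, (1 : ℝ) := by
        gcongr with i
        rw [Real.norm_of_nonneg (hx i).1.le]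
        exact pow_le_one₀ (hx i).1.le (hx i).2
    _ = d := by simp

theorem measurePreserving_toTorus :
    MeasurePreserving (toTorus (d := d)) (volume.restrict (unitCube d)) (torusMeasure d) := by
  have hpi : MeasurePreserving (fun (x : Fin d → ℝ) (i : Fin d) => (x i : UnitAddCircle))
      (Measure.pi fun _ : Fin d => volume.restrict (Set.Ioc (0 : ℝ) (0 + 1)))
      (Measure.pi fun _ : Fin d => volume) :=
    measurePreserving_pi _ _ fun _ : Fin d => UnitAddCircle.measurePreserving_mk 0
  rw [← Measure.restrict_pi_pi] at hpi
  rw [torusMeasure_eq_volume, unitCube_eq_preimage]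
  exact hpi.comp ((PiLp.volume_preserving_ofLp (Fin d)).restrict_preimage
    (MeasurableSet.univ_pi fun _ => measurableSet_Ioc))

section Periodic

variable {F : Type*} [NormedAddCommGroup F] {g : EuclideanSpace ℝ (Fin d) → F}

theorem exists_norm_le_of_periodic (hg : Continuous g)
    (hper : ∀ x y, toTorus x = toTorus y → g x = g y) : ∃ M, ∀ x, ‖g x‖ ≤ M := by
  let p : C(EuclideanSpace ℝ (Fin d), UnitAddTorus (Fin d)) :=
    ⟨toTorus, isQuotientMap_toTorus.continuous⟩
  have hp : IsQuotientMap p := isQuotientMap_toTorus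
  refine ⟨‖hp.lift ⟨g, hg⟩ hper‖, fun x => ?_⟩
  have hx : hp.lift ⟨g, hg⟩ hper (toTorus x) = g x :=
    DFunLike.congr_fun (hp.lift_comp ⟨g, hg⟩ hper) x
  exact hx ▸ ContinuousMap.norm_coe_le_norm _ _

theorem fderiv_eq_of_periodic [NormedSpace ℝ F] (hper : ∀ x y, toTorus x = toTorus y → g x = g y)
    {x y : EuclideanSpace ℝ (Fin d)} (h : toTorus x = toTorus y) : fderiv ℝ g x = fderiv ℝ g y := by
  have hshift : (fun z => g (z + (y - x))) = g := by
    funext z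
    exact hper _ _ (by rw [toTorus_add, toTorus_sub, h, sub_self, add_zero])
  rw [← hshift, fderiv_comp_add_right, add_sub_cancel, hshift]

end Periodic

namespace IsC2Torus

variable {f : UnitAddTorus (Fin d) → ℝ} (hf : IsC2Torus f)

include hf

theorem continuous : Continuous f :=
  isQuotientMap_toTorus.continuous_iff.2 (ContDiff.continuous hf)

theorem differentiable_fderiv :
    Differentiable ℝ (fderiv ℝ fun x : EuclideanSpace ℝ (Fin d) => f (toTorus x)) :=
  (ContDiff.fderiv_right (m := 1) hf (by norm_num)).differentiable (by norm_num)

theorem exists_lipschitzWith_fderiv :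
    ∃ K, LipschitzWith K (fderiv ℝ fun x : EuclideanSpace ℝ (Fin d) => f (toTorus x)) := by
  set F := fun x : EuclideanSpace ℝ (Fin d) => f (toTorus x)
  obtain ⟨M, hM⟩ := exists_norm_le_of_periodic (g := fderiv ℝ (fderiv ℝ F))
    ((ContDiff.fderiv_right (m := 1) hf (by norm_num)).continuous_fderiv (by norm_num))
    fun _ _ => fderiv_eq_of_periodic fun _ _ => fderiv_eq_of_periodic fun x y h => congrArg f h
  exact ⟨M.toNNReal, lipschitzWith_of_nnnorm_fderiv_le hf.differentiable_fderiv
    fun x => NNReal.le_toNNReal_of_coe_le (hM x)⟩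

theorem exists_abs_secondDiff_le :
    ∃ C : ℝ, 0 ≤ C ∧ ∀ x (y : EuclideanSpace ℝ (Fin d)),
      |secondDiff f x (toTorus y)| ≤ C * ‖y‖ ^ 2 := by
  obtain ⟨K, hK⟩ := hf.exists_lipschitzWith_fderiv
  refine ⟨2 * K, by positivity, fun x y => ?_⟩
  obtain ⟨z, rfl⟩ := isQuotientMap_toTorus.surjective x
  have h := abs_second_difference_le (ContDiff.differentiable hf (by norm_num)) hK z y
  rw [secondDiff, ← toTorus_add, ← toTorus_sub, ← abs_neg]
  convert h using 2
  ring

theorem tendsto_secondDiff (x : UnitAddTorus (Fin d)) :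
    Tendsto (fun h : ℝ => ∑ j, secondDiff f x (toTorus (h • EuclideanSpace.single j 1)) / h ^ 2)
      (𝓝[≠] 0) (𝓝 (-torusLaplacian f x)) := by
  obtain ⟨z, rfl⟩ := isQuotientMap_toTorus.surjective x
  have hC : ContDiff ℝ 2 fun y : EuclideanSpace ℝ (Fin d) => f (toTorus z + toTorus y) := by
    simp only [← toTorus_add]
    exact ContDiff.comp (g := fun x : EuclideanSpace ℝ (Fin d) => f (toTorus x)) hf
      (contDiff_const.add contDiff_id)
  rw [torusLaplacian, InnerProductSpace.laplacian_eq_iteratedFDeriv_orthonormalBasis _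
    (EuclideanSpace.basisFun (Fin d) ℝ), ← Finset.sum_neg_distrib]
  refine tendsto_finsetSum _ fun j _ => ?_
  have hj := (tendsto_second_difference_div_sq (x := 0) (hC.differentiable (by norm_num))
    ((hC.fderiv_right (m := 1) (by norm_num)).differentiable (by norm_num) 0)
    (EuclideanSpace.single j 1)).neg
  rw [iteratedFDeriv_two_apply]
  simp only [EuclideanSpace.basisFun_apply, Matrix.cons_val_zero, Matrix.cons_val_one]
  refine hj.congr fun h => ?_
  simp only [zero_add, toTorus_neg, toTorus_zero, add_zero, secondDiff, sub_eq_add_neg]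
  ring

end IsC2Torus

end Torus

open UnitAddTorus

section Fourier

variable {d : ℕ}

theorem mFourier_apply_add {ι : Type*} [Fintype ι] (n : ι → ℤ) (x y : UnitAddTorus ι) :
    mFourier n (x + y) = mFourier n x * mFourier n y := by
  simp [mFourier, fourier_apply, Finset.prod_mul_distrib, AddCircle.toCircle_add]

theorem mFourier_toTorus (n : Fin d → ℤ) (y : EuclideanSpace ℝ (Fin d)) :
    mFourier n (toTorus y) = Complex.exp ((2 * π * ∑ i, n i * y i : ℝ) * Complex.I) := by
  simp only [mFourier, ContinuousMap.coe_mk, toTorus, fourier_coe_apply, ← Complex.exp_sum]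
  congr 1
  push_cast
  rw [Finset.mul_sum, Finset.sum_mul]
  exact Finset.sum_congr rfl fun i _ => by ring

theorem mFourierCoeff_eq_integral_mul (u : UnitAddTorus (Fin d) → ℂ) (n : Fin d → ℤ) :
    mFourierCoeff u n = ∫ t, mFourier (-n) t * u t ∂torusMeasure d := rfl

theorem mFourierCoeff_zero_eq_integral (u : UnitAddTorus (Fin d) → ℂ) :
    mFourierCoeff u 0 = ∫ t, u t ∂torusMeasure d := by
  simp [mFourierCoeff_eq_integral_mul, mFourier_zero]

theorem mFourierCoeff_translate (u : UnitAddTorus (Fin d) → ℂ) (n : Fin d → ℤ)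
    (t : UnitAddTorus (Fin d)) :
    mFourierCoeff (fun x => u (x + t)) n = mFourier n t * mFourierCoeff u n := by
  have hinv : mFourier n t * mFourier (-n) t = 1 := by
    rw [← mFourier_add, add_neg_cancel, mFourier_zero, ContinuousMap.one_apply]
  rw [mFourierCoeff_eq_integral_mul, mFourierCoeff_eq_integral_mul, ← integral_const_mul,
    ← integral_add_right_eq_self (fun x => mFourier n t * (mFourier (-n) x * u x)) t]
  refine integral_congr_ae (.of_forall fun x => ?_)
  simp only [mFourier_apply_add]
  linear_combination -(mFourier (-n) x * u (x + t)) * hinv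

theorem mFourierCoeff_translate_sub {u : UnitAddTorus (Fin d) → ℂ} (hu : Continuous u)
    (n : Fin d → ℤ) (t : UnitAddTorus (Fin d)) :
    mFourierCoeff (fun x => u (x + t) - u x) n = (mFourier n t - 1) * mFourierCoeff u n := by
  rw [sub_mul, one_mul, ← mFourierCoeff_translate]
  simp only [mFourierCoeff_eq_integral_mul, mul_sub]
  exact integral_sub (integrable_of_continuous (by fun_prop))
    (integrable_of_continuous (by fun_prop))

theorem hasSum_sq_mFourierCoeff_of_continuous {u : UnitAddTorus (Fin d) → ℂ} (hu : Continuous u) :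
    HasSum (fun n => ‖mFourierCoeff u n‖ ^ 2) (∫ t, ‖u t‖ ^ 2 ∂torusMeasure d) := by
  let v : C(UnitAddTorus (Fin d), ℂ) := ⟨u, hu⟩
  have hsum := hasSum_sq_mFourierCoeff (v.toLp 2 (torusMeasure d) ℂ)
  have hcoeff : ∀ n, mFourierCoeff (v.toLp 2 (torusMeasure d) ℂ) n = mFourierCoeff u n :=
    mFourierCoeff_toLp v
  simp_rw [hcoeff] at hsum
  convert! hsum using 1
  refine integral_congr_ae ?_
  filter_upwards [v.coeFn_toLp (p := 2) (𝕜 := ℂ) (torusMeasure d)] with x hx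
  rw [hx]
  rfl

theorem hasSum_norm_mFourier_sub_one_sq {u : UnitAddTorus (Fin d) → ℂ} (hu : Continuous u)
    (t : UnitAddTorus (Fin d)) :
    HasSum (fun n => ‖mFourier n t - 1‖ ^ 2 * ‖mFourierCoeff u n‖ ^ 2)
      (∫ x, ‖u (x + t) - u x‖ ^ 2 ∂torusMeasure d) := by
  have hsum := hasSum_sq_mFourierCoeff_of_continuous
    (u := fun x => u (x + t) - u x) (by fun_prop)
  simpa only [mFourierCoeff_translate_sub hu, norm_mul, mul_pow] using hsum

theorem tendsto_norm_mFourier_sub_one_sq (n : Fin d → ℤ) (j : Fin d) :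
    Tendsto (fun h : ℝ => ‖mFourier n (toTorus (h • EuclideanSpace.single j 1)) - 1‖ ^ 2 / h ^ 2)
      (𝓝[≠] 0) (𝓝 (4 * π ^ 2 * (n j : ℝ) ^ 2)) := by
  have hderiv : HasDerivAt (fun h : ℝ => mFourier n (toTorus (h • EuclideanSpace.single j 1)))
      ((2 * π * n j : ℝ) * Complex.I) 0 := by
    have hexp : ∀ h : ℝ, mFourier n (toTorus (h • EuclideanSpace.single j 1))
        = Complex.exp ((2 * π * n j * h : ℝ) * Complex.I) := fun h => by
      rw [mFourier_toTorus]
      simp [mul_assoc]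
    simp only [hexp]
    have := (((hasDerivAt_id (0 : ℝ)).const_mul (2 * π * n j)).ofReal_comp.mul_const
      Complex.I).cexp
    simpa using this
  have hnorm : ‖((2 * π * n j : ℝ) : ℂ) * Complex.I‖ ^ 2 = 4 * π ^ 2 * (n j : ℝ) ^ 2 := by
    rw [norm_mul, Complex.norm_I, mul_one, Complex.norm_real, Real.norm_eq_abs, sq_abs]
    ring
  rw [← hnorm]
  refine ((hasDerivAt_iff_tendsto_slope_zero.1 hderiv).norm.pow 2).congr fun h => ?_
  rw [norm_smul, mul_pow, norm_inv, inv_pow, Real.norm_eq_abs, sq_abs, div_eq_inv_mul, zero_add,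
    zero_smul, toTorus_zero, ← toTorus_zero, mFourier_toTorus n 0]
  simp

theorem one_le_sum_sq_of_ne_zero {ι : Type*} [Fintype ι] {n : ι → ℤ} (hn : n ≠ 0) :
    1 ≤ ∑ j, (n j : ℝ) ^ 2 := by
  obtain ⟨j, hj⟩ := Function.ne_iff.1 hn
  have h1 : 1 ≤ (n j : ℝ) ^ 2 := by
    exact_mod_cast Int.add_one_le_iff.2 (sq_pos_of_ne_zero hj)
  exact h1.trans (Finset.single_le_sum (f := fun j => (n j : ℝ) ^ 2) (fun i _ => sq_nonneg _)
    (Finset.mem_univ j))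

section Poincare

variable {u : UnitAddTorus (Fin d) → ℂ} {a : ℝ → ℝ} {L : ℝ}

theorem sum_sq_mFourierCoeff_le_of_tendsto (hu : Continuous u)
    (hle : ∀ h, ∑ j, (∫ x, ‖u (x + toTorus (h • EuclideanSpace.single j 1)) - u x‖ ^ 2
      ∂torusMeasure d) / h ^ 2 ≤ a h)
    (ha : Tendsto a (𝓝[≠] 0) (𝓝 L)) (s : Finset (Fin d → ℤ)) :
    4 * π ^ 2 * ∑ n ∈ s, (if n = 0 then 0 else ‖mFourierCoeff u n‖ ^ 2) ≤ L := by
  have hlim : Tendsto (fun h : ℝ => ∑ j, ∑ n ∈ s,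
      ‖mFourier n (toTorus (h • EuclideanSpace.single j 1)) - 1‖ ^ 2 / h ^ 2
        * ‖mFourierCoeff u n‖ ^ 2) (𝓝[≠] 0)
      (𝓝 (∑ j, ∑ n ∈ s, 4 * π ^ 2 * (n j : ℝ) ^ 2 * ‖mFourierCoeff u n‖ ^ 2)) :=
    tendsto_finsetSum _ fun j _ => tendsto_finsetSum _ fun n _ =>
      (tendsto_norm_mFourier_sub_one_sq n j).mul_const _
  have hbound : ∑ j, ∑ n ∈ s, 4 * π ^ 2 * (n j : ℝ) ^ 2 * ‖mFourierCoeff u n‖ ^ 2 ≤ L := by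
    refine le_of_tendsto_of_tendsto' hlim ha fun h => le_trans ?_ (hle h)
    refine Finset.sum_le_sum fun j _ => ?_
    simp_rw [div_mul_eq_mul_div, ← Finset.sum_div]
    gcongr
    exact sum_le_hasSum s (fun n _ => by positivity) (hasSum_norm_mFourier_sub_one_sq hu _)
  refine le_trans ?_ hbound
  rw [Finset.sum_comm, Finset.mul_sum]
  refine Finset.sum_le_sum fun n _ => ?_
  rw [← Finset.sum_mul, ← Finset.mul_sum]
  split_ifs with hn
  · rw [mul_zero]
    positivity
  · exact mul_le_mul_of_nonneg_right
      (le_mul_of_one_le_right (by positivity) (one_le_sum_sq_of_ne_zero hn)) (by positivity)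

/-- Poincaré's inequality with the Dirichlet energy replaced by a limit of difference quotients, so
that no differentiability of `u` is involved. -/
theorem poincare_of_tendsto (hu : Continuous u)
    (hle : ∀ h, ∑ j, (∫ x, ‖u (x + toTorus (h • EuclideanSpace.single j 1)) - u x‖ ^ 2
      ∂torusMeasure d) / h ^ 2 ≤ a h)
    (ha : Tendsto a (𝓝[≠] 0) (𝓝 L)) :
    4 * π ^ 2 * (∫ x, ‖u x‖ ^ 2 ∂torusMeasure d - ‖∫ x, u x ∂torusMeasure d‖ ^ 2) ≤ L := by
  have hsum := (hasSum_ite_sub_hasSum (hasSum_sq_mFourierCoeff_of_continuous hu) 0).mul_left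
    (4 * π ^ 2)
  rw [mFourierCoeff_zero_eq_integral] at hsum
  refine hasSum_le_of_sum_le hsum fun s => ?_
  rw [← Finset.mul_sum]
  exact sum_sq_mFourierCoeff_le_of_tendsto hu hle ha s

end Poincare

end Fourier

namespace IsC2Torus

variable {d : ℕ} {f : UnitAddTorus (Fin d) → ℝ} (hf : IsC2Torus f)

include hf

theorem exists_abs_sum_secondDiff_div_sq_le :
    ∃ C : ℝ, ∀ x (h : ℝ),
      |∑ j, secondDiff f x (toTorus (h • EuclideanSpace.single j 1)) / h ^ 2| ≤ C := by
  obtain ⟨C, hC0, hC⟩ := hf.exists_abs_secondDiff_le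
  refine ⟨d * C, fun x h => ?_⟩
  have hterm : ∀ j : Fin d,
      |secondDiff f x (toTorus (h • EuclideanSpace.single j 1)) / h ^ 2| ≤ C := fun j => by
    rw [abs_div, abs_of_nonneg (sq_nonneg h)]
    refine div_le_of_le_mul₀ (sq_nonneg h) hC0 ((hC x _).trans_eq ?_)
    simp [norm_smul]
  calc |∑ j, secondDiff f x (toTorus (h • EuclideanSpace.single j 1)) / h ^ 2|
      ≤ ∑ _j : Fin d, C :=
        (Finset.abs_sum_le_sum_abs _ _).trans (Finset.sum_le_sum fun j _ => hterm j)
    _ = d * C := by simp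

theorem tendsto_integral_secondDiff {ψ : UnitAddTorus (Fin d) → ℝ} (hψ : Continuous ψ) :
    Tendsto (fun h : ℝ => ∑ j, (∫ x, secondDiff f x (toTorus (h • EuclideanSpace.single j 1)) * ψ x
        ∂torusMeasure d) / h ^ 2)
      (𝓝[≠] 0) (𝓝 (-∫ x, torusLaplacian f x * ψ x ∂torusMeasure d)) := by
  obtain ⟨C, hC⟩ := hf.exists_abs_sum_secondDiff_div_sq_le
  have hcont : ∀ t, Continuous fun x => secondDiff f x t := fun t =>
    (continuous_secondDiff hf.continuous).comp (by fun_prop : Continuous fun x => (x, t))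
  have hint : ∀ t (h : ℝ), Integrable (fun x => secondDiff f x t * ψ x / h ^ 2) (torusMeasure d) :=
    fun t h => integrable_of_continuous (((hcont t).mul hψ).div_const _)
  have hsum : ∀ h : ℝ, ∑ j, (∫ x, secondDiff f x (toTorus (h • EuclideanSpace.single j 1)) * ψ x
        ∂torusMeasure d) / h ^ 2
      = ∫ x, (∑ j, secondDiff f x (toTorus (h • EuclideanSpace.single j 1)) / h ^ 2) * ψ x
        ∂torusMeasure d := fun h => by
    simp_rw [Finset.sum_mul, div_mul_eq_mul_div]
    rw [integral_finsetSum _ fun j _ => hint _ h]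
    simp_rw [integral_div]
  simp_rw [hsum, ← integral_neg, ← neg_mul]
  refine tendsto_integral_filter_of_dominated_convergence (fun x => C * |ψ x|)
    (.of_forall fun h => ?_) (.of_forall fun h => .of_forall fun x => ?_)
    (integrable_of_continuous (by fun_prop))
    (.of_forall fun x => (hf.tendsto_secondDiff x).mul_const _)
  · exact ((continuous_finsetSum _ fun j _ => (hcont _).div_const _).mul hψ).aestronglyMeasurable
  · rw [norm_mul, Real.norm_eq_abs, Real.norm_eq_abs]
    exact mul_le_mul_of_nonneg_right (hC x h) (abs_nonneg _)

theorem memLp (p : ENNReal) : MemLp f p (torusMeasure d) :=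
  hf.continuous.memLp_of_hasCompactSupport (HasCompactSupport.of_compactSpace f)

theorem variance_signedPow_le {q : ℝ} (hq : 1 < q) :
    16 * π ^ 2 * ((q - 1) / q ^ 2) * (∫ x, |f x| ^ q ∂torusMeasure d
        - (∫ x, signedPow (q / 2) (f x) ∂torusMeasure d) ^ 2)
      ≤ -∫ x, torusLaplacian f x * signedPow (q - 1) (f x) ∂torusMeasure d := by
  have hκ : 0 < 4 * (q - 1) / q ^ 2 := by
    have : 0 < q - 1 := by linarith
    positivity
  have hu : Continuous fun x => (signedPow (q / 2) (f x) : ℂ) :=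
    Complex.continuous_ofReal.comp ((continuous_signedPow (by linarith)).comp hf.continuous)
  have hlim := (hf.tendsto_integral_secondDiff
    ((continuous_signedPow (show 0 < q - 1 by linarith)).comp hf.continuous)).div_const
    (4 * (q - 1) / q ^ 2)
  have hpoincare := poincare_of_tendsto hu (fun h => ?_) hlim
  · have hsq : ∀ x, ‖(signedPow (q / 2) (f x) : ℂ)‖ ^ 2 = |f x| ^ q := fun x => by
      rw [Complex.norm_real, Real.norm_eq_abs, sq_abs, signedPow_half_sq (by linarith)]
    rw [integral_complex_ofReal, Complex.norm_real, Real.norm_eq_abs, sq_abs, le_div_iff₀ hκ]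
      at hpoincare
    simp only [hsq] at hpoincare
    refine le_of_eq_of_le ?_ hpoincare
    ring
  · rw [Finset.sum_div]
    refine Finset.sum_le_sum fun j _ => ?_
    rw [div_right_comm]
    refine div_le_div_of_nonneg_right ?_ (sq_nonneg h)
    rw [le_div_iff₀' hκ]
    refine le_of_eq_of_le ?_
      (integral_sq_signedPow_sub_le_integral_secondDiff_mul hf.continuous hq _)
    simp_rw [← Complex.ofReal_sub, Complex.norm_real, Real.norm_eq_abs, sq_abs, sub_sq_comm]

theorem integral_laplacian_mul_signedPow_ge (h0 : HasMeanZero f) {q : ℝ} (hq : 1 < q) :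
    8 * π ^ 2 * ((q - 1) / q ^ 2) * ∫ x, |f x| ^ q ∂torusMeasure d
      ≤ -∫ x, torusLaplacian f x * signedPow (q - 1) (f x) ∂torusMeasure d := by
  have hc : 0 ≤ 8 * π ^ 2 * ((q - 1) / q ^ 2) := by
    have : 0 ≤ q - 1 := by linarith
    positivity
  have hvar := integral_abs_rpow_le_two_mul_variance_signedPow hq (hf.memLp _) h0
  calc 8 * π ^ 2 * ((q - 1) / q ^ 2) * ∫ x, |f x| ^ q ∂torusMeasure d
      ≤ 8 * π ^ 2 * ((q - 1) / q ^ 2) * (2 * (∫ x, |f x| ^ q ∂torusMeasure d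
          - (∫ x, signedPow (q / 2) (f x) ∂torusMeasure d) ^ 2)) :=
        mul_le_mul_of_nonneg_left hvar hc
    _ = 16 * π ^ 2 * ((q - 1) / q ^ 2) * (∫ x, |f x| ^ q ∂torusMeasure d
          - (∫ x, signedPow (q / 2) (f x) ∂torusMeasure d) ^ 2) := by ring
    _ ≤ -∫ x, torusLaplacian f x * signedPow (q - 1) (f x) ∂torusMeasure d :=
        hf.variance_signedPow_le hq

end IsC2Torus

section FracKernel

variable {E : Type*} [NormedAddCommGroup E] [InnerProductSpace ℝ E] {α : ℝ}

/-- The kernel `|y| ^ (-(dim E + α))` of the fractional Laplacian of order `α` on a Euclidean space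
`E`. -/
noncomputable def fracKernel (α : ℝ) (y : E) : ℝ := ‖y‖ ^ (-(Module.finrank ℝ E + α))

theorem fracKernel_nonneg (y : E) : 0 ≤ fracKernel α y :=
  Real.rpow_nonneg (norm_nonneg y) _

theorem fracKernel_pos {y : E} (hy : y ≠ 0) : 0 < fracKernel α y :=
  Real.rpow_pos_of_pos (norm_pos_iff.2 hy) _

theorem fracKernel_smul {r : ℝ} (hr : 0 ≤ r) (y : E) :
    fracKernel α (r • y) = r ^ (-(Module.finrank ℝ E + α)) * fracKernel α y := by
  rw [fracKernel, norm_smul, Real.norm_of_nonneg hr, Real.mul_rpow hr (norm_nonneg y), fracKernel]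

theorem abs_mul_fracKernel_le {C s : ℝ} {y : E} (h1 : |s| ≤ C * ‖y‖ ^ 2) (h2 : |s| ≤ C) :
    ‖s * fracKernel α y‖ ≤ C * (min (‖y‖ ^ 2) 1 * fracKernel α y) := by
  rw [norm_mul, Real.norm_eq_abs, Real.norm_of_nonneg (fracKernel_nonneg y), ← mul_assoc]
  refine mul_le_mul_of_nonneg_right ?_ (fracKernel_nonneg y)
  rcases min_choice (‖y‖ ^ 2) 1 with h | h <;> rw [h]
  · exact h1
  · rwa [mul_one]

variable [MeasurableSpace E] [BorelSpace E]

theorem measurable_fracKernel : Measurable (fracKernel (E := E) α) :=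
  measurable_norm.pow_const _

variable [FiniteDimensional ℝ E]

theorem integrable_min_mul_fracKernel [Nontrivial E] (h0 : 0 < α) (h2 : α < 2) :
    Integrable fun y : E => min (‖y‖ ^ 2) 1 * fracKernel α y := by
  have hdim : 1 ≤ Module.finrank ℝ E := Module.finrank_pos
  have hpow : ∀ r : ℝ, 0 < r → ∀ p : ℝ,
      r ^ (Module.finrank ℝ E - 1) * (r ^ p * r ^ (-(Module.finrank ℝ E + α)))
        = r ^ (p - 1 - α) := fun r hr p => by
    rw [← Real.rpow_natCast, ← Real.rpow_add hr, ← Real.rpow_add hr]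
    push_cast [hdim]
    ring_nf
  unfold fracKernel
  rw [integrable_fun_norm_addHaar (E := E) volume
    (f := fun r : ℝ => min (r ^ 2) 1 * r ^ (-(Module.finrank ℝ E + α))),
    ← Set.Ioc_union_Ioi_eq_Ioi (zero_le_one (α := ℝ)), integrableOn_union]
  constructor
  · have hnear : IntegrableOn (fun r : ℝ => r ^ (2 - 1 - α)) (Set.Ioc 0 1) :=
      (intervalIntegrable_iff_integrableOn_Ioc_of_le zero_le_one).1
        (intervalIntegral.intervalIntegrable_rpow' (by linarith))
    refine hnear.congr_fun (fun r hr => ?_) measurableSet_Ioc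
    simp only [smul_eq_mul]
    rw [min_eq_left (pow_le_one₀ hr.1.le hr.2), ← hpow r hr.1 2, Real.rpow_two]
  · have hfar : IntegrableOn (fun r : ℝ => r ^ (0 - 1 - α)) (Set.Ioi 1) :=
      integrableOn_Ioi_rpow_of_lt (by linarith) zero_lt_one
    refine hfar.congr_fun (fun r hr => ?_) measurableSet_Ioi
    have hr1 : 1 < r := hr
    simp only [smul_eq_mul]
    rw [min_eq_right (one_le_pow₀ hr1.le), ← hpow r (by linarith) 0, Real.rpow_zero]

theorem integrable_one_sub_cos_mul_fracKernel [Nontrivial E] (h0 : 0 < α) (h2 : α < 2) (ξ : E) :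
    Integrable fun y => (1 - cos (inner ℝ ξ y)) * fracKernel α y := by
  refine ((integrable_min_mul_fracKernel h0 h2).const_mul (max (‖ξ‖ ^ 2 / 2) 2)).mono'
    ((Continuous.measurable (by fun_prop)).mul measurable_fracKernel).aestronglyMeasurable
    (.of_forall fun y => abs_mul_fracKernel_le ?_ ?_) <;>
  rw [abs_of_nonneg (by linarith [cos_le_one (inner ℝ ξ y)])]
  · have hinner : inner ℝ ξ y ^ 2 ≤ (‖ξ‖ * ‖y‖) ^ 2 :=
      sq_le_sq' (neg_le_of_abs_le (abs_real_inner_le_norm ξ y)) (real_inner_le_norm ξ y)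
    calc 1 - cos (inner ℝ ξ y) ≤ inner ℝ ξ y ^ 2 / 2 := by
          linarith [Real.one_sub_sq_div_two_le_cos (x := inner ℝ ξ y)]
      _ ≤ ‖ξ‖ ^ 2 / 2 * ‖y‖ ^ 2 := by linarith
      _ ≤ max (‖ξ‖ ^ 2 / 2) 2 * ‖y‖ ^ 2 := by gcongr; exact le_max_left _ _
  · exact le_trans (by linarith [neg_one_le_cos (inner ℝ ξ y)]) (le_max_right _ _)

/-- The Fourier symbol, up to a factor `2`, of convolution with `fracKernel α`: the operator
`f ↦ ∫ y, (2 f x - f (x + y) - f (x - y)) * fracKernel α y` multiplies the frequency `ξ` by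
`2 * fracSymbol α ξ`. -/
noncomputable def fracSymbol (α : ℝ) (ξ : E) : ℝ :=
  ∫ y, (1 - cos (inner ℝ ξ y)) * fracKernel α y

theorem fracSymbol_zero : fracSymbol α (0 : E) = 0 := by
  simp [fracSymbol]

theorem fracSymbol_smul {r : ℝ} (hr : 0 < r) (ξ : E) :
    fracSymbol α (r • ξ) = r ^ α * fracSymbol α ξ := by
  have hscale : ∀ y : E, (1 - cos (inner ℝ (r • ξ) y)) * fracKernel α y
      = r ^ (Module.finrank ℝ E + α)
        * ((1 - cos (inner ℝ ξ (r • y))) * fracKernel α (r • y)) := fun y => by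
    rw [fracKernel_smul hr.le, real_inner_smul_left, real_inner_smul_right, Real.rpow_neg hr.le]
    field_simp
  simp_rw [fracSymbol, hscale]
  rw [integral_const_mul, Measure.integral_comp_smul volume
    (fun y : E => (1 - cos (inner ℝ ξ y)) * fracKernel α y) r, abs_of_pos (by positivity),
    smul_eq_mul, ← mul_assoc, Real.rpow_add hr, Real.rpow_natCast]
  congr 1
  field_simp

theorem fracSymbol_eq_of_norm_eq {ξ η : E} (h : ‖ξ‖ = ‖η‖) : fracSymbol α ξ = fracSymbol α η := by
  let ρ := (ℝ ∙ (ξ - η))ᗮ.reflection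
  have hρ : ρ ξ = η := Submodule.reflection_sub h
  rw [fracSymbol, fracSymbol, ← ρ.measurePreserving.integral_comp
    ρ.toHomeomorph.measurableEmbedding (fun y => (1 - cos (inner ℝ η y)) * fracKernel α y)]
  simp only [← hρ, fracKernel, LinearIsometryEquiv.inner_map_map, LinearIsometryEquiv.norm_map]

theorem fracSymbol_pos [Nontrivial E] (h0 : 0 < α) (h2 : α < 2) {ξ : E} (hξ : ξ ≠ 0) :
    0 < fracSymbol α ξ := by
  have hnonneg : ∀ y, 0 ≤ (1 - cos (inner ℝ ξ y)) * fracKernel α y := fun y =>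
    mul_nonneg (sub_nonneg.2 (cos_le_one _)) (fracKernel_nonneg y)
  rw [fracSymbol, integral_pos_iff_support_of_nonneg hnonneg
    (integrable_one_sub_cos_mul_fracKernel h0 h2 ξ)]
  have hopen : IsOpen {y : E | inner ℝ ξ y ∈ Set.Ioo 0 (2 * π)} :=
    isOpen_Ioo.preimage (by fun_prop)
  refine (hopen.measure_pos volume ⟨(‖ξ‖ ^ 2)⁻¹ • ξ, ?_⟩).trans_le (measure_mono fun y hy => ?_)
  · have hinner : inner ℝ ξ ((‖ξ‖ ^ 2)⁻¹ • ξ) = 1 := by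
      rw [real_inner_smul_right, real_inner_self_eq_norm_sq, inv_mul_cancel₀ (by positivity)]
    rw [Set.mem_ofPred_eq, hinner]
    exact ⟨one_pos, by linarith [pi_gt_three]⟩
  · obtain ⟨hpos, hlt⟩ : inner ℝ ξ y ∈ Set.Ioo 0 (2 * π) := hy
    have hy0 : y ≠ 0 := by
      rintro rfl
      simp at hpos
    have hcos : cos (inner ℝ ξ y) ≠ 1 := fun h =>
      hpos.ne' ((Real.cos_eq_one_iff_of_lt_of_lt (by linarith [pi_pos]) hlt).1 h)
    exact mul_ne_zero (sub_ne_zero.2 hcos.symm) (fracKernel_pos hy0).ne'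

theorem exists_fracSymbol_eq_mul_norm_rpow [Nontrivial E] (h0 : 0 < α) (h2 : α < 2) :
    ∃ A : ℝ, 0 < A ∧ ∀ ξ : E, fracSymbol α ξ = A * ‖ξ‖ ^ α := by
  obtain ⟨e, he⟩ := exists_norm_eq E zero_le_one
  refine ⟨fracSymbol α e, fracSymbol_pos h0 h2 (norm_pos_iff.1 (he ▸ one_pos)), fun ξ => ?_⟩
  rcases eq_or_ne ξ 0 with rfl | hξ
  · rw [fracSymbol_zero, norm_zero, Real.zero_rpow h0.ne', mul_zero]
  · rw [mul_comm, ← fracSymbol_smul (norm_pos_iff.2 hξ)]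
    exact fracSymbol_eq_of_norm_eq (by rw [norm_smul, he, norm_norm, mul_one])

end FracKernel

section IntegralPairing

variable {X : Type*} [TopologicalSpace X] [CompactSpace X] [MeasurableSpace X]
  [OpensMeasurableSpace X] {ν : Measure X} {h : X → ℂ}

theorem integrable_continuousMap_mul (hh : Integrable h ν) (χ : C(X, ℂ)) :
    Integrable (fun x => χ x * h x) ν :=
  hh.bdd_mul χ.continuous.aestronglyMeasurable (.of_forall fun x => χ.norm_coe_le_norm x)

/-- The continuous functional `χ ↦ ∫ χ h` on `C(X, ℂ)` defined by an integrable function `h`. -/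
noncomputable def integralPairing (hh : Integrable h ν) : C(X, ℂ) →L[ℂ] ℂ :=
  LinearMap.mkContinuous
    { toFun := fun χ => ∫ x, χ x * h x ∂ν
      map_add' := fun χ₁ χ₂ => by
        simp only [ContinuousMap.add_apply, add_mul]
        exact integral_add (integrable_continuousMap_mul hh χ₁) (integrable_continuousMap_mul hh χ₂)
      map_smul' := fun c χ => by
        simp only [ContinuousMap.smul_apply, smul_eq_mul, mul_assoc, RingHom.id_apply]
        exact integral_const_mul c _ }
    (∫ x, ‖h x‖ ∂ν) fun χ => by
      rw [mul_comm, ← integral_const_mul]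
      refine norm_integral_le_of_norm_le (hh.norm.const_mul _) (.of_forall fun x => ?_)
      rw [norm_mul]
      exact mul_le_mul_of_nonneg_right (χ.norm_coe_le_norm x) (norm_nonneg _)

end IntegralPairing

section FracLaplacian

variable {d : ℕ} {α : ℝ} {f : UnitAddTorus (Fin d) → ℝ}

theorem integral_mul_eq_of_mFourierCoeff_eq {g₁ g₂ : UnitAddTorus (Fin d) → ℂ}
    (h₁ : Integrable g₁ (torusMeasure d)) (h₂ : Integrable g₂ (torusMeasure d))
    (hcoeff : ∀ n, mFourierCoeff g₁ n = mFourierCoeff g₂ n) (χ : C(UnitAddTorus (Fin d), ℂ)) :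
    ∫ x, χ x * g₁ x ∂torusMeasure d = ∫ x, χ x * g₂ x ∂torusMeasure d := by
  have heq : integralPairing h₁ = integralPairing h₂ := by
    refine ContinuousLinearMap.ext_on
      (Submodule.dense_iff_topologicalClosure_eq_top.2 span_mFourier_closure_eq_top) ?_
    rintro _ ⟨n, rfl⟩
    simpa only [mFourierCoeff_eq_integral_mul, neg_neg] using! hcoeff (-n)
  exact DFunLike.congr_fun heq χ

theorem IsFracLaplacian.integral_mul_eq {g₁ g₂ ψ : UnitAddTorus (Fin d) → ℝ}
    (h₁ : IsFracLaplacian α f g₁) (h₂ : IsFracLaplacian α f g₂) (hψ : Continuous ψ) :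
    ∫ x, g₁ x * ψ x ∂torusMeasure d = ∫ x, g₂ x * ψ x ∂torusMeasure d := by
  have h := integral_mul_eq_of_mFourierCoeff_eq h₁.1.ofReal h₂.1.ofReal
    (fun n => (h₁.2 n).trans (h₂.2 n).symm) ⟨fun x => (ψ x : ℂ), by fun_prop⟩
  simp only [ContinuousMap.coe_mk, Complex.coe_algebraMap, ← Complex.ofReal_mul,
    integral_complex_ofReal, mul_comm (ψ _)] at h
  exact Complex.ofReal_injective h

/-- The (unnormalised) fractional Laplacian of order `α` as a hypersingular integral. -/
noncomputable def fracIntegral (α : ℝ) (f : UnitAddTorus (Fin d) → ℝ) (x : UnitAddTorus (Fin d)) :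
    ℝ :=
  ∫ y : EuclideanSpace ℝ (Fin d), secondDiff f x (toTorus y) * fracKernel α y

/-- The angular frequency `2πn` of the character `mFourier n`. -/
noncomputable def angularFreq (n : Fin d → ℤ) : EuclideanSpace ℝ (Fin d) :=
  WithLp.toLp 2 fun i => 2 * π * n i

theorem inner_angularFreq (n : Fin d → ℤ) (y : EuclideanSpace ℝ (Fin d)) :
    inner ℝ (angularFreq n) y = 2 * π * ∑ i, n i * y i := by
  rw [PiLp.inner_apply, Finset.mul_sum]
  refine Finset.sum_congr rfl fun i _ => ?_
  simp only [angularFreq, RCLike.inner_apply, conj_trivial]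
  ring

theorem norm_angularFreq (n : Fin d → ℤ) :
    ‖angularFreq n‖ = 2 * π * √(∑ i, (n i : ℝ) ^ 2) := by
  simp only [EuclideanSpace.norm_eq, angularFreq, Real.norm_eq_abs, sq_abs, mul_pow (2 * π)]
  rw [← Finset.mul_sum, Real.sqrt_mul (by positivity), Real.sqrt_sq (by positivity)]

theorem mFourierCoeff_secondDiff (hf : Continuous f) (n : Fin d → ℤ)
    (y : EuclideanSpace ℝ (Fin d)) :
    mFourierCoeff (fun x => (secondDiff f x (toTorus y) : ℂ)) n
      = (2 * (1 - cos (inner ℝ (angularFreq n) y)) : ℝ) * mFourierCoeff (fun x => (f x : ℂ)) n := by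
  have hsplit : ∀ x, (secondDiff f x (toTorus y) : ℂ)
      = -((f (x + toTorus y) : ℂ) - f x) - ((f (x + toTorus (-y)) : ℂ) - f x) := fun x => by
    rw [secondDiff, toTorus_neg, ← sub_eq_add_neg]
    push_cast
    ring
  have hcos : mFourier n (toTorus y) + mFourier n (toTorus (-y))
      = 2 * Complex.cos (inner ℝ (angularFreq n) y : ℝ) := by
    rw [Complex.two_cos, mFourier_toTorus, mFourier_toTorus, ← inner_angularFreq,
      ← inner_angularFreq, inner_neg_right, Complex.ofReal_neg]
  have hcont : Continuous fun x => (f x : ℂ) := by fun_prop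
  calc mFourierCoeff (fun x => (secondDiff f x (toTorus y) : ℂ)) n
      = -mFourierCoeff (fun x => (f (x + toTorus y) : ℂ) - f x) n
        - mFourierCoeff (fun x => (f (x + toTorus (-y)) : ℂ) - f x) n := by
        simp only [hsplit, mFourierCoeff_eq_integral_mul, mul_sub (mFourier (-n) _) (-_), mul_neg]
        rw [integral_sub (integrable_of_continuous (by fun_prop))
          (integrable_of_continuous (by fun_prop)), integral_neg]
    _ = (2 * (1 - cos (inner ℝ (angularFreq n) y)) : ℝ) * mFourierCoeff (fun x => (f x : ℂ)) n := by
        rw [mFourierCoeff_translate_sub hcont, mFourierCoeff_translate_sub hcont]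
        push_cast
        linear_combination -mFourierCoeff (fun x => (f x : ℂ)) n * hcos

theorem le_fracKernel_of_mem_unitCube [NeZero d] (h0 : 0 ≤ α) {y : EuclideanSpace ℝ (Fin d)}
    (hy : y ∈ unitCube d) : √d ^ (-(d + α)) ≤ fracKernel α y := by
  have hy0 : y ≠ 0 := by
    rintro rfl
    exact lt_irrefl _ (hy 0).1
  rw [fracKernel, finrank_euclideanSpace_fin]
  exact Real.rpow_le_rpow_of_nonpos (norm_pos_iff.2 hy0) (norm_le_sqrt_of_mem_unitCube hy)
    (neg_nonpos.2 (by positivity))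

theorem integral_fracKernel_mul_comp_toTorus_ge [NeZero d] (h0 : 0 ≤ α)
    {I : UnitAddTorus (Fin d) → ℝ} (hI0 : ∀ t, 0 ≤ I t) (hI : Integrable I (torusMeasure d))
    (hIker : Integrable fun y => fracKernel α y * I (toTorus y)) :
    √d ^ (-(d + α)) * ∫ t, I t ∂torusMeasure d ≤ ∫ y, fracKernel α y * I (toTorus y) := by
  have hcube : ∫ t, I t ∂torusMeasure d = ∫ y in unitCube d, I (toTorus y) := by
    rw [← measurePreserving_toTorus.map_eq]
    exact integral_map measurePreserving_toTorus.aemeasurable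
      (measurePreserving_toTorus.map_eq ▸ hI.aestronglyMeasurable)
  rw [hcube, ← integral_const_mul]
  calc ∫ y in unitCube d, √d ^ (-(d + α)) * I (toTorus y)
      ≤ ∫ y in unitCube d, fracKernel α y * I (toTorus y) :=
        setIntegral_mono_on
          ((measurePreserving_toTorus.integrable_comp_of_integrable hI).const_mul _)
          hIker.integrableOn measurableSet_unitCube fun y hy =>
            mul_le_mul_of_nonneg_right (le_fracKernel_of_mem_unitCube h0 hy) (hI0 _)
    _ ≤ ∫ y, fracKernel α y * I (toTorus y) :=
        setIntegral_le_integral hIker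
          (.of_forall fun y => mul_nonneg (fracKernel_nonneg y) (hI0 _))

namespace IsC2Torus

variable [NeZero d] (hf : IsC2Torus f) (h0 : 0 < α) (h2 : α < 2)

include hf h0 h2

theorem integrable_secondDiff_mul_fracKernel :
    Integrable (fun p : UnitAddTorus (Fin d) × EuclideanSpace ℝ (Fin d) =>
      secondDiff f p.1 (toTorus p.2) * fracKernel α p.2) ((torusMeasure d).prod volume) := by
  obtain ⟨C, _, hC⟩ := hf.exists_abs_secondDiff_le
  have hmeas : Continuous fun p : UnitAddTorus (Fin d) × EuclideanSpace ℝ (Fin d) =>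
      secondDiff f p.1 (toTorus p.2) :=
    (continuous_secondDiff hf.continuous).comp
      (continuous_fst.prodMk (isQuotientMap_toTorus.continuous.comp continuous_snd))
  have hbound : Integrable (fun p : UnitAddTorus (Fin d) × EuclideanSpace ℝ (Fin d) =>
      min (‖p.2‖ ^ 2) 1 * fracKernel α p.2) ((torusMeasure d).prod volume) :=
    (integrable_min_mul_fracKernel h0 h2).comp_snd _
  refine (hbound.const_mul (max C (4 * ‖(⟨f, hf.continuous⟩ : C(_, ℝ))‖))).mono'
    (hmeas.measurable.mul (measurable_fracKernel.comp measurable_snd)).aestronglyMeasurable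
    (.of_forall fun p => abs_mul_fracKernel_le ?_ ?_)
  · exact (hC _ _).trans (by gcongr; exact le_max_left _ _)
  · exact (abs_secondDiff_le_of_abs_le
      (fun x => ContinuousMap.norm_coe_le_norm ⟨f, hf.continuous⟩ x) _ _).trans (le_max_right _ _)

theorem integrable_fracIntegral : Integrable (fracIntegral α f) (torusMeasure d) :=
  (hf.integrable_secondDiff_mul_fracKernel h0 h2).integral_prod_left

section TestFunction

variable {F : Type*} [NormedAddCommGroup F] [NormedSpace ℝ F] {χ : UnitAddTorus (Fin d) → F}

theorem integrable_secondDiff_mul_fracKernel_smul (hχ : Continuous χ) :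
    Integrable (fun p : UnitAddTorus (Fin d) × EuclideanSpace ℝ (Fin d) =>
      (secondDiff f p.1 (toTorus p.2) * fracKernel α p.2) • χ p.1)
      ((torusMeasure d).prod volume) :=
  (hf.integrable_secondDiff_mul_fracKernel h0 h2).smul_bdd ‖(⟨χ, hχ⟩ : C(_, F))‖
    (hχ.comp continuous_fst).aestronglyMeasurable
    (.of_forall fun p => ContinuousMap.norm_coe_le_norm ⟨χ, hχ⟩ p.1)

theorem integrable_fracKernel_smul_integral (hχ : Continuous χ) :
    Integrable fun y : EuclideanSpace ℝ (Fin d) =>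
      fracKernel α y • ∫ x, secondDiff f x (toTorus y) • χ x ∂torusMeasure d := by
  simp_rw [← integral_smul, smul_smul, mul_comm (fracKernel α _)]
  exact (hf.integrable_secondDiff_mul_fracKernel_smul h0 h2 hχ).integral_prod_right

theorem integral_fracIntegral_smul [CompleteSpace F] (hχ : Continuous χ) :
    ∫ x, fracIntegral α f x • χ x ∂torusMeasure d
      = ∫ y : EuclideanSpace ℝ (Fin d),
          fracKernel α y • ∫ x, secondDiff f x (toTorus y) • χ x ∂torusMeasure d := by
  simp_rw [fracIntegral, ← integral_smul_const, ← integral_smul, smul_smul,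
    mul_comm (fracKernel α _)]
  exact integral_integral_swap (hf.integrable_secondDiff_mul_fracKernel_smul h0 h2 hχ)

end TestFunction

theorem mFourierCoeff_fracIntegral (n : Fin d → ℤ) :
    mFourierCoeff (fun x => (fracIntegral α f x : ℂ)) n
      = (2 * fracSymbol α (angularFreq n) : ℝ) * mFourierCoeff (fun x => (f x : ℂ)) n := by
  have hcomm : ∀ g : UnitAddTorus (Fin d) → ℝ, mFourierCoeff (fun x => (g x : ℂ)) n
      = ∫ x, g x • mFourier (-n) x ∂torusMeasure d := fun g => by
    simp_rw [mFourierCoeff_eq_integral_mul, Complex.real_smul, mul_comm]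
  calc mFourierCoeff (fun x => (fracIntegral α f x : ℂ)) n
      = ∫ y, fracKernel α y • mFourierCoeff (fun x => (secondDiff f x (toTorus y) : ℂ)) n := by
        simp_rw [hcomm]
        exact hf.integral_fracIntegral_smul h0 h2 (mFourier (-n)).continuous
    _ = ∫ y, ((2 * ((1 - cos (inner ℝ (angularFreq n) y)) * fracKernel α y) : ℝ) : ℂ)
          * mFourierCoeff (fun x => (f x : ℂ)) n := by
        simp_rw [mFourierCoeff_secondDiff hf.continuous, Complex.real_smul]
        congr with y
        push_cast
        ring
    _ = (2 * fracSymbol α (angularFreq n) : ℝ) * mFourierCoeff (fun x => (f x : ℂ)) n := by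
        rw [integral_mul_const, integral_complex_ofReal, integral_const_mul, fracSymbol]

theorem isFracLaplacian {A : ℝ} (hA : A ≠ 0)
    (hsymbol : ∀ ξ : EuclideanSpace ℝ (Fin d), fracSymbol α ξ = A * ‖ξ‖ ^ α) :
    IsFracLaplacian α f fun x => (2 * A)⁻¹ * fracIntegral α f x := by
  refine ⟨(hf.integrable_fracIntegral h0 h2).const_mul _, fun n => ?_⟩
  have hscale : mFourierCoeff (fun x => (((2 * A)⁻¹ * fracIntegral α f x : ℝ) : ℂ)) n
      = ((2 * A)⁻¹ : ℝ) * mFourierCoeff (fun x => (fracIntegral α f x : ℂ)) n := by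
    simp_rw [mFourierCoeff_eq_integral_mul, ← integral_const_mul, Complex.ofReal_mul, mul_left_comm]
  rw [hscale, hf.mFourierCoeff_fracIntegral h0 h2, hsymbol, norm_angularFreq, ← mul_assoc,
    ← Complex.ofReal_mul]
  congr 2
  field_simp

theorem integral_fracIntegral_mul_signedPow_ge (hm : HasMeanZero f) {q : ℝ} (hq : 1 < q) :
    2 * √d ^ (-(d + α)) * ∫ x, |f x| ^ q ∂torusMeasure d
      ≤ ∫ x, fracIntegral α f x * signedPow (q - 1) (f x) ∂torusMeasure d := by
  have hψ : Continuous fun x => signedPow (q - 1) (f x) :=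
    (continuous_signedPow (by linarith)).comp hf.continuous
  have htotal : ∫ t, ∫ x, secondDiff f x t * signedPow (q - 1) (f x) ∂torusMeasure d ∂torusMeasure d
      = 2 * ∫ x, |f x| ^ q ∂torusMeasure d := by
    rw [integral_integral_secondDiff_mul hf.continuous hψ, hm, zero_mul, sub_zero]
    simp_rw [mul_signedPow_sub_one (show q ≠ 0 by linarith)]
  calc 2 * √d ^ (-(d + α)) * ∫ x, |f x| ^ q ∂torusMeasure d
      = √d ^ (-(d + α)) * ∫ t, ∫ x, secondDiff f x t * signedPow (q - 1) (f x)
          ∂torusMeasure d ∂torusMeasure d := by rw [htotal]; ring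
    _ ≤ ∫ y, fracKernel α y * ∫ x, secondDiff f x (toTorus y) * signedPow (q - 1) (f x)
          ∂torusMeasure d :=
        integral_fracKernel_mul_comp_toTorus_ge h0.le
          (integral_secondDiff_mul_signedPow_nonneg hf.continuous hq)
          (integrable_integral_secondDiff_mul hf.continuous hψ)
          (hf.integrable_fracKernel_smul_integral h0 h2 hψ)
    _ = ∫ x, fracIntegral α f x * signedPow (q - 1) (f x) ∂torusMeasure d :=
        (hf.integral_fracIntegral_smul h0 h2 hψ).symm

end IsC2Torus

end FracLaplacian

theorem corollary1p4 :
    (∀ (d : ℕ) (_ : 1 ≤ d) (α : ℝ) (_ : 0 < α) (_ : α < 2),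
      ∃ c₁ : ℝ, 0 < c₁ ∧
        ∀ f : UnitAddTorus (Fin d) → ℝ, IsC2Torus f → HasMeanZero f →
          (∃ g : UnitAddTorus (Fin d) → ℝ, IsFracLaplacian α f g) ∧
          ∀ g : UnitAddTorus (Fin d) → ℝ, IsFracLaplacian α f g →
            ∀ q : ℝ, 1 < q →
              ∫ x, g x * (|f x| ^ (q - 2) * f x) ∂(torusMeasure d) ≥
                c₁ * ∫ x, |f x| ^ q ∂(torusMeasure d)) ∧
    (∃ c₂ : ℝ, 0 < c₂ ∧
      ∀ (d : ℕ) (_ : 1 ≤ d) (f : UnitAddTorus (Fin d) → ℝ), IsC2Torus f → HasMeanZero f →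
        ∀ q : ℝ, 1 < q →
          -∫ x, torusLaplacian f x * (|f x| ^ (q - 2) * f x) ∂(torusMeasure d) ≥
            c₂ * ((q - 1) / q ^ 2) * ∫ x, |f x| ^ q ∂(torusMeasure d)) := by
  simp_rw [abs_rpow_sub_two_mul]
  constructor
  · intro d hd α h0 h2
    have : NeZero d := ⟨by lia⟩
    obtain ⟨A, hA, hsymbol⟩ :=
      exists_fracSymbol_eq_mul_norm_rpow (E := EuclideanSpace ℝ (Fin d)) h0 h2
    refine ⟨A⁻¹ * √d ^ (-(d + α)), by positivity, fun f hf hm => ?_⟩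
    have hg₀ := hf.isFracLaplacian h0 h2 hA.ne' hsymbol
    refine ⟨⟨_, hg₀⟩, fun g hg q hq => ?_⟩
    have hψ : Continuous fun x => signedPow (q - 1) (f x) :=
      (continuous_signedPow (by linarith)).comp hf.continuous
    calc ∫ x, g x * signedPow (q - 1) (f x) ∂torusMeasure d
        = (2 * A)⁻¹ * ∫ x, fracIntegral α f x * signedPow (q - 1) (f x) ∂torusMeasure d := by
          rw [hg.integral_mul_eq hg₀ hψ, ← integral_const_mul]
          simp_rw [mul_assoc]
      _ ≥ (2 * A)⁻¹ * (2 * √d ^ (-(d + α)) * ∫ x, |f x| ^ q ∂torusMeasure d) := by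
          gcongr
          exact hf.integral_fracIntegral_mul_signedPow_ge h0 h2 hm hq
      _ = A⁻¹ * √d ^ (-(d + α)) * ∫ x, |f x| ^ q ∂torusMeasure d := by field_simp
  · exact ⟨8 * π ^ 2, by positivity, fun d _ f hf hm q hq =>
      hf.integral_laplacian_mul_signedPow_ge hm hq⟩
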